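/- **Model.** Consider a network $(M,T,p_i,\alpha_i)$ with $M\ge 1$ clients, frames of $T\ge 1$ slots, channel reliabilities $p_i\in(0,1]$ and weights $\alpha_i>0$. At the beginning of every frame $k=1,2,\dots$ a new packet is generated for every client and replaces its undelivered packet, if any. In each slot the base station either idles or transmits the packet of one client whose packet of the current frame is still undelivered; a transmission to client $i$ succeeds with probability $p_i$, independently of the past, and the base station learns the outcome at once. Let $\Pi$ be the class of all non-anticipative (possibly randomized) policies, i.e. the decision in a slot depends only on the past decisions and feedback. Let $h_{k,i}$ be the number of frames since the last delivery to client $i$: $h_{k+1,i}=1$ if client $i$ received its packet in frame $k$, and $h_{k+1,i}=h_{k,i}+1$ otherwise, with a given initial vector $\vec h_1$ of positive integers. The performance of $\pi\in\Pi$ with horizon $K$ is $$\mathbb{E}[J_K^\pi],\qquad J_K^{\pi}=\frac{1}{KM}\sum_{k=1}^{K}\sum_{i=1}^{M}\alpha_i h_{k,i}^{\pi}.$$ A policy $\pi\in\Pi$ is called $\rho$-optimal (over an infinite time-horizon) if $$\limsup_{K\to\infty}\frac{\mathbb{E}[J_K^{\pi}]}{\inf_{\eta\in\Pi}\mathbb{E}[J_K^{\eta}]}\le\rho\qquad\text{and}\qquad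 \limsup_{K\to\infty}\mathbb{E}[J_K^{\pi}]\le\rho\,\liminf_{K\to\infty}\mathbb{E}[J_K^{\eta}]\quad\text{for every }\eta\in\Pi.$$ **Whittle's Index policy.** In each slot of frame $k$ in which some packet is undelivered, transmit to a client with the highest value of $$C_i(h_{k,i})=p_i\alpha_i h_{k,i}\left[h_{k,i}+\frac{1+(1-p_i)^T}{1-(1-p_i)^T}\right]$$ among the clients with an undelivered packet, with ties broken arbitrarily. **Theorem (Performance of Whittle).** For every network $(M,T,p_i,\alpha_i)$ and every initial vector $\vec h_1$, the Whittle's Index policy (with any tie-breaking) is $\rho^{WI}$-optimal over an infinite time-horizon, where $$\rho^{WI}=4\,\frac{\left(\sum_{i=1}^{M}\sqrt{\widetilde\alpha_i/p_i}\right)^2+(T-1)\sum_{i=1}^M\widetilde\alpha_i/p_i}{\left(\sum_{i=1}^{M}\sqrt{\alpha_i/p_i}\right)^2+T\sum_{i=1}^M\alpha_i},\qquad \widetilde\alpha_i=\frac{\alpha_i}{2}\left(\frac{2}{1-(1-p_i)^T}+1\right)^2 .$$ -/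

import Mathlib

open Filter
open scoped ENNReal NNReal

/-- A network `(M, T, p, α)`: `M` clients, frames of `T ≥ 1` slots, channel reliabilities
`p i ∈ (0, 1]` and weights `α i > 0`. -/
structure Network (M : ℕ) where
  T : ℕ
  p : Fin M → ℝ
  α : Fin M → ℝ
  T_pos : 0 < T
  p_pos : ∀ i, 0 < p i
  p_le_one : ∀ i, p i ≤ 1
  α_pos : ∀ i, 0 < α i

/-- What the base station observes in one slot: its decision (`none` means that it idles) and the
feedback (`true` means that the transmitted packet was delivered). -/
abbrev SlotRecord (M : ℕ) := Option (Fin M) × Bool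

/-- The records of all slots so far, the most recent slot first. A history of length
`(k - 1) * T + (n - 1)` is what is known at the beginning of slot `n` of frame `k`. -/
abbrev History (M : ℕ) := List (SlotRecord M)

/-- The clients that have received the packet of the current frame after a slot with record `r`,
if those in `D` had received it before that slot. -/
def addDelivery {M : ℕ} (D : Finset (Fin M)) (r : SlotRecord M) : Finset (Fin M) :=
  if r.2 then D ∪ r.1.toFinset else D

namespace Network

variable {M : ℕ} (N : Network M)

/-- The clients that have already received the packet of the current frame (the frame to which the
slot following the history belongs). New packets are generated at the beginning of every frame. -/
def delivered : History M → Finset (Fin M)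
  | [] => ∅
  | r :: w => if N.T ∣ w.length + 1 then ∅ else addDelivery (delivered w) r

/-- The vector `h_k` of the numbers of frames since the last delivery, in the current frame `k`,
started at `h₁`. It changes only at the end of a frame. -/
def age (h₁ : Fin M → ℕ) : History M → Fin M → ℕ
  | [] => h₁
  | r :: w =>
    if N.T ∣ w.length + 1 then
      fun i => if i ∈ addDelivery (N.delivered w) r then 1 else age h₁ w i + 1
    else age h₁ w

/-- The probability that a decision results in a delivery. -/
noncomputable def successProb : Option (Fin M) → ℝ≥0
  | none => 0
  | some i => (N.p i).toNNReal

theorem successProb_le_one (u : Option (Fin M)) : N.successProb u ≤ 1 := by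
  cases u with
  | none => simp [successProb]
  | some i => simpa [successProb] using N.p_le_one i

/-- The feedback after a decision: `true` with probability `successProb u`, otherwise `false`. -/
noncomputable def feedback (u : Option (Fin M)) : PMF Bool :=
  PMF.ofFintype
    (fun s => if s then (N.successProb u : ℝ≥0∞) else 1 - (N.successProb u : ℝ≥0∞)) (by
      have h : (N.successProb u : ℝ≥0∞) ≤ 1 := by exact_mod_cast N.successProb_le_one u
      simpa using add_tsub_cancel_of_le h)

/-- A non-anticipative scheduling policy, possibly randomized: in every slot it draws its decision
from a distribution that depends only on the history, and it either idles or selects a client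
with an undelivered packet. -/
structure Policy where
  decision : History M → PMF (Option (Fin M))
  admissible : ∀ w i, some i ∈ (decision w).support → i ∉ N.delivered w

variable {N}

/-- The law of the history of the first `t` slots under the policy `π`: each transmission to client
`i` succeeds with probability `p i`, independently of the past. -/
noncomputable def Policy.law (π : N.Policy) : ℕ → PMF (History M)
  | 0 => PMF.pure []
  | t + 1 => (π.law t).bind fun w => (π.decision w).bind fun u =>
      (N.feedback u).map fun s => (u, s) :: w

variable (N)

/-- The objective `J_K = (1 / (K M)) ∑_{k=1}^K ∑_i α_i h_{k,i}` along a history of `K` frames.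
The summation index `k` stands for frame `k + 1`, and `w.rtake (k * T)` is the part of the history
that precedes that frame. -/
noncomputable def objective (h₁ : Fin M → ℕ) (K : ℕ) (w : History M) : ℝ :=
  1 / ((K : ℝ) * (M : ℝ)) *
    ∑ k ∈ Finset.range K, ∑ i, N.α i * (N.age h₁ (w.rtake (k * N.T)) i : ℝ)

variable {N}

/-- The expected objective `E[J_K^π]`. -/
noncomputable def Policy.cost (π : N.Policy) (h₁ : Fin M → ℕ) (K : ℕ) : ℝ≥0∞ :=
  ∑' w, π.law (K * N.T) w * ENNReal.ofReal (N.objective h₁ K w)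

/-- `π` is `ρ`-optimal over an infinite time horizon. The first part: the optimality ratio
`E[J_K^π] / inf_η E[J_K^η]` is asymptotically at most `ρ` as `K → ∞`. The second part: the
infinite-horizon cost of `π` is at most `ρ` times that of any policy `η`. Limits of costs that
need not exist are read as `limsup` for `π` and as `liminf` for `η`. -/
def Policy.IsRhoOptimal (π : N.Policy) (h₁ : Fin M → ℕ) (ρ : ℝ) : Prop :=
  limsup (fun K => π.cost h₁ K / ⨅ η : N.Policy, η.cost h₁ K) atTop ≤ ENNReal.ofReal ρ ∧
  ∀ η : N.Policy, limsup (fun K => π.cost h₁ K) atTop ≤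
    ENNReal.ofReal ρ * liminf (fun K => η.cost h₁ K) atTop

variable (N)

/-- Whittle's index `C_i(h)`. -/
noncomputable def whittleIndex (i : Fin M) (h : ℕ) : ℝ :=
  N.p i * N.α i * h * (h + (1 + (1 - N.p i) ^ N.T) / (1 - (1 - N.p i) ^ N.T))

variable {N}

/-- `π` is a Whittle's Index policy: in every slot in which some packet is undelivered it transmits
to a client with the highest index among the clients with an undelivered packet. Ties may be
broken in any way, also at random or depending on the history. -/
def Policy.IsWhittle (π : N.Policy) (h₁ : Fin M → ℕ) : Prop :=
  ∀ w, ∀ u ∈ (π.decision w).support, (∃ j, j ∉ N.delivered w) →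
    ∃ i, u = some i ∧ ∀ j, j ∉ N.delivered w →
      N.whittleIndex j (N.age h₁ w j) ≤ N.whittleIndex i (N.age h₁ w i)

variable (N)

/-- The modified weight `α̃_i`. -/
noncomputable def alphaTilde (i : Fin M) : ℝ :=
  N.α i / 2 * (2 / (1 - (1 - N.p i) ^ N.T) + 1) ^ 2

/-- The performance guarantee `ρ^{WI}`. -/
noncomputable def rhoWI : ℝ :=
  4 * (((∑ i, √(N.alphaTilde i / N.p i)) ^ 2 + ((N.T : ℝ) - 1) * ∑ i, N.alphaTilde i / N.p i) /
    ((∑ i, √(N.α i / N.p i)) ^ 2 + (N.T : ℝ) * ∑ i, N.α i))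

end Network

/-! Both bounds come from potential functions of the ages whose drift is controlled over a frame and
telescoped over K frames.

Lower bound, for every policy: charge a price `μ / (2 * p i)` per delivery. A slot then costs at
most `μ / 2` in expectation, so a frame costs at most `T * μ / 2`, and the priced problem splits
into one deterministic problem per client: serve it every `x i` frames, at average cost `α i * (x i
+ 1/2)`. The relative values of these problems form the potential
(`Policy.le_sum_mean_weightedAge`); the best price gives `lowerConst / (2 * T)` per frame.

Upper bound, for Whittle: the index is `p i` times the decrease of a quadratic Lyapunov function
caused by a delivery to `i`. An interchange argument (`attemptValue_le_of_index_le`) shows that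
picking the largest index maximizes the expected total decrease in a frame. Hence the drift is no
worse than under any fixed randomized choice of clients (`sum_le_slotValue`), and suitable
probabilities bound the average weighted age by `2 * upperConst / T` (`lyapunov_sub_slotValue_le`).

The quotient of the two constants is `rhoWI`; the boundary terms vanish after division by K. -/

namespace PMF

/-! ### Integration against a `PMF` -/

theorem tsum_bind_mul {β γ : Type*} (p : PMF β) (f : β → PMF γ) (g : γ → ℝ≥0∞) :
    ∑' b, p.bind f b * g b = ∑' a, p a * ∑' b, f a b * g b := by
  simp_rw [PMF.bind_apply, ← ENNReal.tsum_mul_right, ← ENNReal.tsum_mul_left]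
  rw [ENNReal.tsum_comm]
  simp_rw [mul_assoc]

theorem tsum_pure_mul {β : Type*} (a : β) (g : β → ℝ≥0∞) :
    ∑' b, PMF.pure a b * g b = g a := by
  classical
  rw [tsum_eq_single a]
  · simp
  · intro b hb
    simp [PMF.pure_apply, hb]

theorem tsum_map_mul {β γ : Type*} (p : PMF β) (f : β → γ) (g : γ → ℝ≥0∞) :
    ∑' b, p.map f b * g b = ∑' a, p a * g (f a) := by
  rw [← PMF.bind_pure_comp, tsum_bind_mul]
  simp_rw [Function.comp_apply, tsum_pure_mul]

theorem sum_toReal_eq_one {β : Type*} [Fintype β] (p : PMF β) : ∑ a, (p a).toReal = 1 := by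
  rw [← ENNReal.toReal_sum fun a _ => p.apply_ne_top a, ← tsum_fintype (L := .unconditional β),
    p.tsum_coe, ENNReal.toReal_one]

end PMF

/-! ### Optimal scheduling inside a frame -/

section Slots

variable {ι : Type*} [DecidableEq ι]

/-- The expected reward when client `i` is tried while the clients in `S` are undelivered, if a
delivery to `i` is worth `W i` and the remaining slots are worth `v`. -/
def attemptValue (p W : ι → ℝ) (v : Finset ι → ℝ) (S : Finset ι) (i : ι) : ℝ :=
  p i * (W i + v (S.erase i)) + (1 - p i) * v S

/-- The largest expected reward in `n` slots if the clients in `S` are undelivered. -/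
noncomputable def slotValue (p W : ι → ℝ) : ℕ → Finset ι → ℝ
  | 0, _ => 0
  | n + 1, S =>
    if h : S.Nonempty then S.sup' h (attemptValue p W (slotValue p W n) S) else 0

variable {p W : ι → ℝ}

theorem slotValue_empty (n : ℕ) : slotValue p W n ∅ = 0 := by
  cases n <;> simp [slotValue]

theorem attemptValue_le_slotValue (n : ℕ) {S : Finset ι} {i : ι} (hi : i ∈ S) :
    attemptValue p W (slotValue p W n) S i ≤ slotValue p W (n + 1) S := by
  have hS : S.Nonempty := ⟨i, hi⟩
  simp only [slotValue, hS, dite_true]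
  exact Finset.le_sup' (attemptValue p W (slotValue p W n) S) hi

theorem slotValue_succ_eq {n : ℕ} {S : Finset ι} {i : ι} (hi : i ∈ S)
    (h : ∀ j ∈ S, attemptValue p W (slotValue p W n) S j ≤
      attemptValue p W (slotValue p W n) S i) :
    slotValue p W (n + 1) S = attemptValue p W (slotValue p W n) S i := by
  refine le_antisymm ?_ (attemptValue_le_slotValue n hi)
  have hS : S.Nonempty := ⟨i, hi⟩
  simp only [slotValue, hS, dite_true]
  exact Finset.sup'_le hS _ h

theorem attemptValue_mono (hp : ∀ i, 0 ≤ p i) (hp1 : ∀ i, p i ≤ 1) {v v' : Finset ι → ℝ}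
    (h : ∀ S, v S ≤ v' S) (S : Finset ι) (i : ι) :
    attemptValue p W v S i ≤ attemptValue p W v' S i := by
  unfold attemptValue
  have h0 := hp i
  have h1 := sub_nonneg.2 (hp1 i)
  gcongr <;> apply h

/-- A client with the largest `p i * W i` is an optimal choice in every slot. -/
theorem attemptValue_le_of_index_le (hp : ∀ i, 0 ≤ p i) (hp1 : ∀ i, p i ≤ 1) (n : ℕ)
    {S : Finset ι} {i : ι} (hi : i ∈ S) (hmax : ∀ j ∈ S, p j * W j ≤ p i * W i) {j : ι}
    (hj : j ∈ S) :
    attemptValue p W (slotValue p W n) S j ≤ attemptValue p W (slotValue p W n) S i := by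
  induction n generalizing S i j with
  | zero => simpa [attemptValue, slotValue] using hmax j hj
  | succ n ih =>
    rcases eq_or_ne j i with rfl | hij
    · exact le_rfl
    -- Interchange: after a first attempt at `j`, client `i` still has the largest index whether or
    -- not `j` succeeded, so by induction `i` comes next. Trying `j` then `i` has the same value as
    -- `i` then `j`, and following `i` by `j` is at most optimal (`g1`, `g2`).
    have e1 := slotValue_succ_eq hi fun j hj => ih hi hmax hj
    have hi' : i ∈ S.erase j := Finset.mem_erase.2 ⟨hij.symm, hi⟩
    have hj' : j ∈ S.erase i := Finset.mem_erase.2 ⟨hij, hj⟩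
    have e2 := slotValue_succ_eq hi' fun k hk =>
      ih hi' (fun k hk => hmax k (Finset.mem_of_mem_erase hk)) hk
    have g1 := attemptValue_le_slotValue (p := p) (W := W) n hj
    have g2 := attemptValue_le_slotValue (p := p) (W := W) n hj'
    have h0 := hp i
    have h1 := sub_nonneg.2 (hp1 i)
    calc attemptValue p W (slotValue p W (n + 1)) S j
        = p i * (W i + attemptValue p W (slotValue p W n) (S.erase i) j) +
          (1 - p i) * attemptValue p W (slotValue p W n) S j := by
          conv_lhs => rw [attemptValue, e1, e2]
          simp only [attemptValue, Finset.erase_right_comm (a := i) (b := j)]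
          ring
      _ ≤ attemptValue p W (slotValue p W (n + 1)) S i := by
          rw [attemptValue.eq_1 p W (slotValue p W (n + 1)) S i]
          gcongr

theorem slotValue_eq_attemptValue (hp : ∀ i, 0 ≤ p i) (hp1 : ∀ i, p i ≤ 1) (n : ℕ)
    {S : Finset ι} {i : ι} (hi : i ∈ S) (hmax : ∀ j ∈ S, p j * W j ≤ p i * W i) :
    slotValue p W (n + 1) S = attemptValue p W (slotValue p W n) S i :=
  slotValue_succ_eq hi fun _ hj => attemptValue_le_of_index_le hp hp1 n hi hmax hj

theorem slotValue_le_succ (hp : ∀ i, 0 ≤ p i) (hp1 : ∀ i, p i ≤ 1) (hW : ∀ i, 0 ≤ W i) (n : ℕ)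
    (S : Finset ι) : slotValue p W n S ≤ slotValue p W (n + 1) S := by
  induction n generalizing S with
  | zero =>
    rcases S.eq_empty_or_nonempty with rfl | ⟨i, hi⟩
    · simp [slotValue_empty]
    · refine le_trans ?_ (attemptValue_le_slotValue 0 hi)
      simpa [attemptValue, slotValue] using mul_nonneg (hp i) (hW i)
  | succ n ih =>
    rcases S.eq_empty_or_nonempty with rfl | hS
    · simp [slotValue_empty]
    · rw [slotValue]
      simp only [hS, dite_true]
      exact Finset.sup'_le hS _ fun i hi =>
        (attemptValue_mono hp hp1 ih S i).trans (attemptValue_le_slotValue (n + 1) hi)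

/-- The optimal reward is at least that of trying, in every slot, client `j` with probability
`β j` (and idling if its packet has already been delivered). -/
theorem sum_le_slotValue (hp : ∀ i, 0 ≤ p i) (hp1 : ∀ i, p i ≤ 1) (hW : ∀ i, 0 ≤ W i)
    {β : ι → ℝ} (hβ : ∀ i, 0 ≤ β i) (n : ℕ) (S : Finset ι) (hβ1 : ∑ i ∈ S, β i ≤ 1) :
    ∑ i ∈ S, W i * (1 - (1 - β i * p i) ^ n) ≤ slotValue p W n S := by
  induction n generalizing S with
  | zero => simp [slotValue]
  | succ n ih =>
    set G : ℝ := ∑ i ∈ S, W i * (1 - (1 - β i * p i) ^ n)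
    have hG : G ≤ slotValue p W n S := ih S hβ1
    -- Try `j` now and randomize afterwards. Only the term of `j` in `G` changes: success now adds
    -- value exactly when the later attempts would have missed `j`.
    have key : ∀ j ∈ S, G + p j * W j * (1 - β j * p j) ^ n ≤ slotValue p W (n + 1) S := by
      intro j hj
      refine le_trans ?_ (attemptValue_le_slotValue n hj)
      have hE : G - W j * (1 - (1 - β j * p j) ^ n) ≤ slotValue p W n (S.erase j) := by
        have := ih (S.erase j) (le_trans (Finset.sum_le_sum_of_subset_of_nonneg
          (Finset.erase_subset j S) fun i _ _ => hβ i) hβ1)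
        rwa [Finset.sum_erase_eq_sub hj] at this
      have h0 := hp j
      have h1 := sub_nonneg.2 (hp1 j)
      calc G + p j * W j * (1 - β j * p j) ^ n
          = p j * (W j + (G - W j * (1 - (1 - β j * p j) ^ n))) + (1 - p j) * G := by ring
        _ ≤ _ := by unfold attemptValue; gcongr
    have hV := hG.trans (slotValue_le_succ hp hp1 hW n S)
    have hsum := Finset.sum_le_sum fun j hj => mul_le_mul_of_nonneg_left (key j hj) (hβ j)
    rw [← Finset.sum_mul] at hsum
    -- The remaining probability is spent idling, which `slotValue` does not offer; its monotonicity
    -- in the number of slots makes up for this.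
    have hidle := mul_le_mul_of_nonneg_left hV (sub_nonneg.2 hβ1)
    have hsplit : ∑ i ∈ S, W i * (1 - (1 - β i * p i) ^ (n + 1)) =
        ∑ j ∈ S, β j * (G + p j * W j * (1 - β j * p j) ^ n) + (1 - ∑ j ∈ S, β j) * G := by
      have : ∑ i ∈ S, W i * (1 - (1 - β i * p i) ^ (n + 1)) =
          G + ∑ j ∈ S, β j * (p j * W j * (1 - β j * p j) ^ n) := by
        rw [← Finset.sum_add_distrib]
        exact Finset.sum_congr rfl fun i _ => by ring
      rw [this]
      simp_rw [mul_add]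
      rw [Finset.sum_add_distrib, ← Finset.sum_mul]
      ring
    rw [hsplit]
    linarith

end Slots

namespace Network

variable {M : ℕ} {N : Network M}

/-! ### Expectations -/

/-- The expectation of `g` of the record of the slot that follows the history `w`. -/
noncomputable def Policy.stepMean (π : N.Policy) (w : History M) (g : SlotRecord M → ℝ) : ℝ :=
  ∑ u, (π.decision w u).toReal *
    ((N.successProb u : ℝ) * g (u, true) + (1 - (N.successProb u : ℝ)) * g (u, false))

/-- The expectation of `g` of the history of the first `t` slots. -/
noncomputable def Policy.mean (π : N.Policy) : ℕ → (History M → ℝ) → ℝ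
  | 0, g => g []
  | t + 1, g => π.mean t fun w => π.stepMean w fun r => g (r :: w)

theorem one_sub_successProb_nonneg (u : Option (Fin M)) : 0 ≤ 1 - (N.successProb u : ℝ) :=
  sub_nonneg.2 (by exact_mod_cast N.successProb_le_one u)

theorem Policy.stepMean_nonneg (π : N.Policy) (w : History M) {g : SlotRecord M → ℝ}
    (hg : ∀ r, 0 ≤ g r) : 0 ≤ π.stepMean w g :=
  Finset.sum_nonneg fun u _ => mul_nonneg ENNReal.toReal_nonneg
    (add_nonneg (mul_nonneg NNReal.zero_le_coe (hg _))
      (mul_nonneg (one_sub_successProb_nonneg u) (hg _)))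

theorem Policy.ofReal_stepMean (π : N.Policy) (w : History M) {g : SlotRecord M → ℝ}
    (hg : ∀ r, 0 ≤ g r) :
    ENNReal.ofReal (π.stepMean w g) =
      ∑' u, π.decision w u * ∑' s, N.feedback u s * ENNReal.ofReal (g (u, s)) := by
  have h1 : ∀ u, 0 ≤ (N.successProb u : ℝ) * g (u, true) := fun u =>
    mul_nonneg NNReal.zero_le_coe (hg _)
  have h2 : ∀ u, 0 ≤ (1 - (N.successProb u : ℝ)) * g (u, false) := fun u =>
    mul_nonneg (one_sub_successProb_nonneg u) (hg _)
  rw [tsum_fintype, Policy.stepMean, ENNReal.ofReal_sum_of_nonneg fun u _ =>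
    mul_nonneg ENNReal.toReal_nonneg (add_nonneg (h1 u) (h2 u))]
  refine Finset.sum_congr rfl fun u _ => ?_
  rw [ENNReal.ofReal_mul ENNReal.toReal_nonneg, ENNReal.ofReal_toReal ((π.decision w).apply_ne_top u),
    ENNReal.ofReal_add (h1 u) (h2 u), ENNReal.ofReal_mul NNReal.zero_le_coe,
    ENNReal.ofReal_mul (one_sub_successProb_nonneg u), tsum_fintype, Fintype.sum_bool,
    ENNReal.ofReal_sub _ NNReal.zero_le_coe, ENNReal.ofReal_coe_nnreal, ENNReal.ofReal_one]
  simp [feedback]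

/-- Moves the computation from `ℝ≥0∞` to the real recursion `mean`, where potentials of either sign
can be subtracted. -/
theorem Policy.tsum_law_mul_ofReal (π : N.Policy) (t : ℕ) {g : History M → ℝ}
    (hg : ∀ w, 0 ≤ g w) :
    ∑' w, π.law t w * ENNReal.ofReal (g w) = ENNReal.ofReal (π.mean t g) := by
  induction t generalizing g with
  | zero => simp [Policy.law, Policy.mean]
  | succ t ih =>
    rw [Policy.law, PMF.tsum_bind_mul, Policy.mean,
      ← ih fun w => π.stepMean_nonneg w fun r => hg (r :: w)]
    refine tsum_congr fun w => ?_
    rw [PMF.tsum_bind_mul, π.ofReal_stepMean w fun r => hg (r :: w)]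
    simp_rw [PMF.tsum_map_mul]

theorem Policy.stepMean_mono (π : N.Policy) (w : History M) {g g' : SlotRecord M → ℝ}
    (h : ∀ r, g r ≤ g' r) : π.stepMean w g ≤ π.stepMean w g' := by
  unfold Policy.stepMean
  have h1 := fun u => one_sub_successProb_nonneg (N := N) u
  gcongr <;> first | apply h | apply h1

theorem Policy.stepMean_le (π : N.Policy) (w : History M) {g : SlotRecord M → ℝ} {c : ℝ}
    (h : ∀ u ∈ (π.decision w).support,
      (N.successProb u : ℝ) * g (u, true) + (1 - (N.successProb u : ℝ)) * g (u, false) ≤ c) :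
    π.stepMean w g ≤ c := by
  calc π.stepMean w g ≤ ∑ u, (π.decision w u).toReal * c := by
        refine Finset.sum_le_sum fun u _ => ?_
        by_cases hu : u ∈ (π.decision w).support
        · exact mul_le_mul_of_nonneg_left (h u hu) ENNReal.toReal_nonneg
        · rw [(π.decision w).apply_eq_zero_iff u |>.2 hu]
          simp
    _ = c := by rw [← Finset.sum_mul, PMF.sum_toReal_eq_one, one_mul]

theorem Policy.stepMean_const (π : N.Policy) (w : History M) (c : ℝ) :
    π.stepMean w (fun _ => c) = c := by
  have : π.stepMean w (fun _ => c) = ∑ u, (π.decision w u).toReal * c :=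
    Finset.sum_congr rfl fun u _ => by ring
  rw [this, ← Finset.sum_mul, PMF.sum_toReal_eq_one, one_mul]

theorem Policy.mean_mono (π : N.Policy) (t : ℕ) {g g' : History M → ℝ}
    (h : ∀ w, w.length = t → g w ≤ g' w) : π.mean t g ≤ π.mean t g' := by
  induction t generalizing g g' with
  | zero => exact h [] rfl
  | succ t ih =>
    exact ih fun w hw => π.stepMean_mono w fun r => h (r :: w) (by simp [hw])

theorem Policy.mean_congr (π : N.Policy) (t : ℕ) {g g' : History M → ℝ}
    (h : ∀ w, w.length = t → g w = g' w) : π.mean t g = π.mean t g' :=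
  le_antisymm (π.mean_mono t fun w hw => (h w hw).le) (π.mean_mono t fun w hw => (h w hw).ge)

theorem Policy.mean_const (π : N.Policy) (t : ℕ) (c : ℝ) : π.mean t (fun _ => c) = c := by
  induction t with
  | zero => rfl
  | succ t ih => simpa [Policy.mean, Policy.stepMean_const] using ih

theorem Policy.mean_add (π : N.Policy) (t : ℕ) (g g' : History M → ℝ) :
    π.mean t (fun w => g w + g' w) = π.mean t g + π.mean t g' := by
  induction t generalizing g g' with
  | zero => rfl
  | succ t ih =>
    rw [Policy.mean, Policy.mean, Policy.mean, ← ih]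
    congr 1
    funext w
    simp only [Policy.stepMean]
    rw [← Finset.sum_add_distrib]
    exact Finset.sum_congr rfl fun u _ => by ring

theorem Policy.mean_mul (π : N.Policy) (t : ℕ) (c : ℝ) (g : History M → ℝ) :
    π.mean t (fun w => c * g w) = c * π.mean t g := by
  induction t generalizing g with
  | zero => rfl
  | succ t ih =>
    rw [Policy.mean, Policy.mean, ← ih]
    congr 1
    funext w
    simp only [Policy.stepMean]
    rw [Finset.mul_sum]
    exact Finset.sum_congr rfl fun u _ => by ring

theorem Policy.mean_sum (π : N.Policy) (t n : ℕ) (g : ℕ → History M → ℝ) :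
    π.mean t (fun w => ∑ k ∈ Finset.range n, g k w) = ∑ k ∈ Finset.range n, π.mean t (g k) := by
  induction n with
  | zero => simpa using π.mean_const t 0
  | succ n ih => simp_rw [Finset.sum_range_succ, Policy.mean_add, ih]

theorem Policy.mean_comp_rtake (π : N.Policy) {s t : ℕ} (h : s ≤ t) (g : History M → ℝ) :
    π.mean t (fun w => g (w.rtake s)) = π.mean s g := by
  induction t, h using Nat.le_induction with
  | base => exact π.mean_congr s fun w hw => by simp [List.rtake, hw]
  | succ t h ih =>
    rw [← ih, Policy.mean]
    refine π.mean_congr t fun w hw => ?_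
    have : ∀ r : SlotRecord M, (r :: w).rtake s = w.rtake s := fun r => by
      simp [List.rtake, hw, Nat.succ_sub h]
    simp_rw [this]
    exact π.stepMean_const w _

/-! ### Frames -/

variable (N)

/-- The weighted sum of the ages. -/
def weightedAge (h : Fin M → ℕ) : ℝ := ∑ i, N.α i * (h i : ℝ)

variable {N}

/-- The ages in the frame after one in which the ages are `h` and the clients in `D` are served. -/
def nextAge (h : Fin M → ℕ) (D : Finset (Fin M)) : Fin M → ℕ :=
  fun i => if i ∈ D then 1 else h i + 1

theorem age_pos {h₁ : Fin M → ℕ} (hh₁ : ∀ i, 1 ≤ h₁ i) (w : History M) (i : Fin M) :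
    1 ≤ N.age h₁ w i := by
  induction w with
  | nil => exact hh₁ i
  | cons r w ih =>
    rw [age]
    split_ifs
    · dsimp only
      split_ifs <;> omega
    · exact ih

theorem delivered_eq_empty {w : History M} (h : N.T ∣ w.length) : N.delivered w = ∅ := by
  cases w with
  | nil => rfl
  | cons r w => simp only [delivered]; rw [if_pos (by simpa using h)]

theorem weightedAge_nonneg (h : Fin M → ℕ) : 0 ≤ N.weightedAge h :=
  Finset.sum_nonneg fun i _ => mul_nonneg (N.α_pos i).le (Nat.cast_nonneg _)

theorem Policy.cost_eq (π : N.Policy) (h₁ : Fin M → ℕ) (K : ℕ) :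
    π.cost h₁ K = ENNReal.ofReal (1 / ((K : ℝ) * (M : ℝ)) *
      ∑ k ∈ Finset.range K, π.mean (k * N.T) fun w => N.weightedAge (N.age h₁ w)) := by
  have h0 : ∀ w, 0 ≤ N.objective h₁ K w := fun w => mul_nonneg (by positivity)
    (Finset.sum_nonneg fun k _ => weightedAge_nonneg (N.age h₁ (w.rtake (k * N.T))))
  rw [Policy.cost, π.tsum_law_mul_ofReal _ h0]
  change ENNReal.ofReal (π.mean (K * N.T) fun w => 1 / ((K : ℝ) * (M : ℝ)) *
    ∑ k ∈ Finset.range K, N.weightedAge (N.age h₁ (w.rtake (k * N.T)))) = _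
  rw [Policy.mean_mul, Policy.mean_sum]
  congr 2
  refine Finset.sum_congr rfl fun k hk => ?_
  exact π.mean_comp_rtake (Nat.mul_le_mul_right _ (Finset.mem_range.1 hk).le)
    fun w => N.weightedAge (N.age h₁ w)

/-- If `F n h D` does not increase on average from slot to slot, where `n` is the number of
remaining slots of the frame, `h` are the ages and `D` are the served clients, then its initial
value bounds the expectation of `G` of the ages in the next frame. -/
theorem Policy.mean_frame_le (π : N.Policy) (h₁ : Fin M → ℕ)
    (F : ℕ → (Fin M → ℕ) → Finset (Fin M) → ℝ) (G : (Fin M → ℕ) → ℝ)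
    (hF : ∀ n w, π.stepMean w (fun r => F n (N.age h₁ w) (addDelivery (N.delivered w) r)) ≤
      F (n + 1) (N.age h₁ w) (N.delivered w))
    (hG : ∀ h D, G (nextAge h D) ≤ F 0 h D) (k : ℕ) :
    π.mean ((k + 1) * N.T) (fun w => G (N.age h₁ w)) ≤
      π.mean (k * N.T) (fun w => F N.T (N.age h₁ w) ∅) := by
  -- The last slot is kept apart from the first `m`: its record resets `delivered` and updates the
  -- ages.
  obtain ⟨m, hm⟩ : ∃ m, N.T = m + 1 := ⟨N.T - 1, by have := N.T_pos; omega⟩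
  have key : ∀ j, j ≤ m →
      π.mean (k * N.T + j) (fun w => F (N.T - j) (N.age h₁ w) (N.delivered w)) ≤
      π.mean (k * N.T) (fun w => F N.T (N.age h₁ w) ∅) := by
    intro j
    induction j with
    | zero =>
      intro _
      refine π.mean_mono _ fun w hw => ?_
      have hw' : w.length = k * N.T := hw
      rw [delivered_eq_empty (hw' ▸ Dvd.intro_left k rfl)]
      exact le_rfl
    | succ j ih =>
      intro hj
      refine le_trans ?_ (ih (by omega))
      rw [← add_assoc, Policy.mean]
      refine π.mean_mono _ fun w hw => ?_
      have hnd : ¬ N.T ∣ w.length + 1 := by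
        rw [hw, add_assoc, Nat.dvd_add_right (Dvd.intro_left k rfl)]
        exact Nat.not_dvd_of_pos_of_lt (by omega) (by omega)
      simp only [age, delivered, hnd, if_false]
      have := hF (N.T - (j + 1)) w
      rwa [show N.T - (j + 1) + 1 = N.T - j by omega] at this
  refine le_trans ?_ (key m le_rfl)
  rw [show (k + 1) * N.T = k * N.T + m + 1 by rw [add_mul]; omega, Policy.mean]
  refine π.mean_mono _ fun w hw => ?_
  have hd : N.T ∣ w.length + 1 := by
    rw [hw, add_assoc, ← hm]
    exact Nat.dvd_add (Dvd.intro_left k rfl) dvd_rfl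
  refine le_trans (π.stepMean_mono w fun r => ?_) ((hF 0 w).trans (by
    rw [show N.T - m = 0 + 1 by omega]))
  simp only [age, hd, if_true]
  exact hG _ _

/-- Telescopes a drift bound over frames. -/
theorem Policy.mean_le_of_frame_le (π : N.Policy) (h₁ : Fin M → ℕ) {G : (Fin M → ℕ) → ℝ}
    {a b : ℝ}
    (h : ∀ k, π.mean ((k + 1) * N.T) (fun w => G (N.age h₁ w)) ≤
      π.mean (k * N.T) (fun w => G (N.age h₁ w) + (a * N.weightedAge (N.age h₁ w) + b))) (K : ℕ) :
    π.mean (K * N.T) (fun w => G (N.age h₁ w)) ≤ G h₁ +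
      (a * (∑ k ∈ Finset.range K, π.mean (k * N.T) fun w => N.weightedAge (N.age h₁ w)) + K * b) := by
  induction K with
  | zero => simp [Policy.mean, age]
  | succ K ih =>
    have := h K
    rw [Policy.mean_add, Policy.mean_add, Policy.mean_mul, Policy.mean_const] at this
    rw [Finset.sum_range_succ]
    push_cast
    linarith

theorem addDelivery_false (D : Finset (Fin M)) (u : Option (Fin M)) :
    addDelivery D (u, false) = D := rfl

theorem addDelivery_none (D : Finset (Fin M)) (s : Bool) : addDelivery D (none, s) = D := by
  cases s <;> simp [addDelivery]

theorem addDelivery_some_true (D : Finset (Fin M)) (i : Fin M) :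
    addDelivery D (some i, true) = insert i D := by
  simp [addDelivery, Finset.union_comm D]

theorem coe_successProb_none : (N.successProb none : ℝ) = 0 := rfl

theorem coe_successProb_some (i : Fin M) : (N.successProb (some i) : ℝ) = N.p i :=
  Real.coe_toNNReal _ (N.p_pos i).le

/-! ### The lower bound for every policy -/

/-- The relative value of a client of age `h` when it is served every `x` frames. -/
noncomputable def relativeValue (x : ℝ) (h : ℕ) : ℝ := (h - 1) * (2 * x + 1 - h) / 2

theorem relativeValue_le (x : ℝ) (h : ℕ) : relativeValue x h ≤ x ^ 2 / 2 := by
  unfold relativeValue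
  nlinarith [sq_nonneg ((h : ℝ) - 1 - x)]

/-- The expected number of transmissions per slot is at most one, so that the sum of `1 / p i` over
the served clients increases by at most one per slot. -/
theorem Policy.stepMean_sum_inv_le (π : N.Policy) (w : History M) {a b : ℝ} (ha : 0 ≤ a) :
    π.stepMean w (fun r => b + a * ∑ i ∈ addDelivery (N.delivered w) r, 1 / N.p i) ≤
      b + a * (∑ i ∈ N.delivered w, 1 / N.p i + 1) := by
  refine π.stepMean_le w fun u hu => ?_
  cases u with
  | none =>
    rw [addDelivery_none, addDelivery_none, coe_successProb_none]
    linarith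
  | some i =>
    have hi := π.admissible w i hu
    rw [addDelivery_false, addDelivery_some_true, Finset.sum_insert hi, coe_successProb_some]
    have := (N.p_pos i).ne'
    refine le_of_eq ?_
    field_simp
    ring

/-- Weak duality with price `μ / 2` on the expected number of transmissions. The hypothesis `hx`
makes `x i` the optimal service period at this price. -/
theorem Policy.le_sum_mean_weightedAge (π : N.Policy) (h₁ : Fin M → ℕ) {x : Fin M → ℝ} {μ : ℝ}
    (hμ : 0 ≤ μ) (hx : ∀ i, N.α i * x i ^ 2 = μ * (1 / N.p i)) (K : ℕ) :
    K * (∑ i, N.α i * (x i + 1 / 2) - N.T * (μ / 2)) -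
        ∑ i, N.α i * (x i ^ 2 / 2 - relativeValue (x i) (h₁ i)) ≤
      ∑ k ∈ Finset.range K, π.mean (k * N.T) fun w => N.weightedAge (N.age h₁ w) := by
  set U : (Fin M → ℕ) → ℝ := fun h => ∑ i, N.α i * relativeValue (x i) (h i) with hU
  set c : ℝ := ∑ i, N.α i * (x i + 1 / 2) with hc
  -- The term `n * (μ / 2)` is the budget of the remaining slots; it pays for the growth of the
  -- price term.
  have hframe := π.mean_frame_le h₁
    (fun n h D => (N.weightedAge h - U h - c + n * (μ / 2)) + μ / 2 * ∑ i ∈ D, 1 / N.p i)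
    (fun h => - U h) (fun n w => by
      refine (π.stepMean_sum_inv_le w (by positivity)).trans (le_of_eq ?_)
      push_cast
      ring) (fun h D => by
      have h1 : ∑ i ∈ D, N.α i * x i ^ 2 = μ * ∑ i ∈ D, 1 / N.p i := by
        rw [Finset.mul_sum]
        exact Finset.sum_congr rfl fun i _ => hx i
      have h2 : ∑ i ∈ D, N.α i * x i ^ 2 = ∑ i, if i ∈ D then N.α i * x i ^ 2 else 0 := by
        rw [Finset.sum_ite_mem, Finset.univ_inter]
      have h3 : U h + c ≤ U (nextAge h D) + N.weightedAge h +
          1 / 2 * ∑ i, if i ∈ D then N.α i * x i ^ 2 else 0 := by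
        simp only [hU, hc, weightedAge]
        rw [Finset.mul_sum, ← Finset.sum_add_distrib, ← Finset.sum_add_distrib,
          ← Finset.sum_add_distrib]
        refine Finset.sum_le_sum fun i _ => ?_
        have hα := N.α_pos i
        by_cases hi : i ∈ D
        · simp only [nextAge, hi, if_true, relativeValue]
          push_cast
          -- The slack is exactly `α * (h - x)^2 / 2`; for an unserved client there is none.
          nlinarith [mul_nonneg hα.le (sq_nonneg ((h i : ℝ) - x i))]
        · simp only [nextAge, hi, if_false, relativeValue]
          push_cast
          refine le_of_eq ?_
          ring
      rw [← h2, h1] at h3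
      push_cast
      linarith)
  have hK := π.mean_le_of_frame_le h₁ (G := fun h => - U h) (a := 1) (b := N.T * (μ / 2) - c)
    (fun k => (hframe k).trans (π.mean_mono _ fun w _ => by
      rw [Finset.sum_empty]
      linarith)) K
  have hlow : - ∑ i, N.α i * (x i ^ 2 / 2) ≤
      π.mean (K * N.T) (fun w => - U (N.age h₁ w)) := by
    rw [← π.mean_const (K * N.T) (- ∑ i, N.α i * (x i ^ 2 / 2))]
    refine π.mean_mono _ fun w _ => neg_le_neg ?_
    exact Finset.sum_le_sum fun i _ =>
      mul_le_mul_of_nonneg_left (relativeValue_le _ _) (N.α_pos i).le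
  have hsplit : ∑ i, N.α i * (x i ^ 2 / 2 - relativeValue (x i) (h₁ i)) =
      ∑ i, N.α i * (x i ^ 2 / 2) - U h₁ := by
    simp only [hU]
    rw [← Finset.sum_sub_distrib]
    exact Finset.sum_congr rfl fun i _ => by ring
  rw [hsplit]
  linarith

variable (N)

/-- The denominator of `ρ^{WI}`. -/
noncomputable def lowerConst : ℝ := (∑ i, √(N.α i / N.p i)) ^ 2 + (N.T : ℝ) * ∑ i, N.α i

/-- The numerator of `ρ^{WI}`. -/
noncomputable def upperConst : ℝ :=
  (∑ i, √(N.alphaTilde i / N.p i)) ^ 2 + ((N.T : ℝ) - 1) * ∑ i, N.alphaTilde i / N.p i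

variable {N}

theorem T_pos_real : (0 : ℝ) < N.T := Nat.cast_pos.2 N.T_pos

/-- The price `μ = (s / T)^2` makes the service rates `1 / x i` use the whole budget: `∑ 1 / (p i *
x i) = T`. The constant `C` is uniform in the policy, as the infimum over policies requires. -/
theorem exists_le_sum_mean_weightedAge (N : Network M) (h₁ : Fin M → ℕ) :
    ∃ C : ℝ, ∀ (π : N.Policy) (K : ℕ), K * (N.lowerConst / (2 * N.T)) - C ≤
      ∑ k ∈ Finset.range K, π.mean (k * N.T) fun w => N.weightedAge (N.age h₁ w) := by
  set s : ℝ := ∑ i, √(N.α i / N.p i) with hs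
  have hT := (T_pos_real (N := N)).ne'
  let x : Fin M → ℝ := fun i => s / N.T * (√(N.α i / N.p i) / N.α i)
  have hsum : ∑ i, N.α i * (x i + 1 / 2) = s ^ 2 / N.T + 1 / 2 * ∑ i, N.α i := by
    have : ∀ i, N.α i * (x i + 1 / 2) = s / N.T * √(N.α i / N.p i) + 1 / 2 * N.α i := fun i => by
      have := (N.α_pos i).ne'
      simp only [x]
      field_simp
    simp_rw [this]
    rw [Finset.sum_add_distrib, ← Finset.mul_sum, ← Finset.mul_sum, ← hs]
    ring
  refine ⟨∑ i, N.α i * (x i ^ 2 / 2 - relativeValue (x i) (h₁ i)), fun π K => le_trans (le_of_eq ?_)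
    (π.le_sum_mean_weightedAge h₁ (x := x) (μ := (s / N.T) ^ 2) (sq_nonneg _) (fun i => ?_) K)⟩
  · rw [hsum]
    congr 2
    rw [lowerConst, ← hs]
    field_simp
    ring
  · have hα := (N.α_pos i).ne'
    have hp := (N.p_pos i).ne'
    simp only [x]
    rw [mul_pow, div_pow (√_), Real.sq_sqrt (div_nonneg (N.α_pos i).le (N.p_pos i).le)]
    field_simp

/-! ### The upper bound for Whittle's Index policy -/

variable (N)

/-- The constant `c` in Whittle's index `p α h (h + c)`. -/
noncomputable def indexOffset (i : Fin M) : ℝ :=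
  (1 + (1 - N.p i) ^ N.T) / (1 - (1 - N.p i) ^ N.T)

/-- The decrease of the Lyapunov function due to a delivery to client `i`. -/
noncomputable def deliveryGain (h : Fin M → ℕ) (i : Fin M) : ℝ :=
  N.α i * (h i * (h i + N.indexOffset i))

/-- The Lyapunov function whose drift Whittle's Index policy minimizes. -/
noncomputable def lyapunov (h : Fin M → ℕ) : ℝ :=
  ∑ i, N.α i * ((h i : ℝ) ^ 2 + (N.indexOffset i - 2) * h i)

variable {N}

theorem one_sub_pow_pos (i : Fin M) : 0 < 1 - (1 - N.p i) ^ N.T := by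
  have := N.p_pos i
  have := pow_lt_one₀ (sub_nonneg.2 (N.p_le_one i)) (by linarith) N.T_pos.ne'
  linarith

theorem one_le_indexOffset (i : Fin M) : 1 ≤ N.indexOffset i := by
  have h1 := N.one_sub_pow_pos i
  have h2 := pow_nonneg (sub_nonneg.2 (N.p_le_one i)) N.T
  rw [indexOffset, le_div_iff₀ h1]
  linarith

theorem alphaTilde_eq (i : Fin M) :
    N.alphaTilde i = N.α i / 2 * (N.indexOffset i + 2) ^ 2 := by
  have h1 := (N.one_sub_pow_pos i).ne'
  rw [alphaTilde, indexOffset]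
  congr 2
  field_simp
  ring

theorem alphaTilde_pos (i : Fin M) : 0 < N.alphaTilde i := by
  have := one_le_indexOffset (N := N) i
  have := N.α_pos i
  rw [alphaTilde_eq]
  positivity

theorem deliveryGain_nonneg (h : Fin M → ℕ) (i : Fin M) : 0 ≤ N.deliveryGain h i := by
  have := one_le_indexOffset (N := N) i
  have := N.α_pos i
  unfold deliveryGain
  positivity

theorem whittleIndex_eq (h : Fin M → ℕ) (i : Fin M) :
    N.whittleIndex i (h i) = N.p i * N.deliveryGain h i := by
  simp only [whittleIndex, deliveryGain, indexOffset]
  ring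

/-- The linear coefficient is only known to be at least -1, so ages at least 1 are needed. -/
theorem lyapunov_nonneg {h : Fin M → ℕ} (hh : ∀ i, 1 ≤ h i) : 0 ≤ N.lyapunov h := by
  refine Finset.sum_nonneg fun i _ => mul_nonneg (N.α_pos i).le ?_
  have h1 := one_le_indexOffset (N := N) i
  have h2 : (1 : ℝ) ≤ h i := by exact_mod_cast hh i
  nlinarith

/-- The linear coefficient `c - 2` is chosen so that resetting `h + 1` to 1 gains exactly `h * (h +
c)`, the factor in Whittle's index. -/
theorem lyapunov_nextAge (h : Fin M → ℕ) (D : Finset (Fin M)) :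
    N.lyapunov (nextAge h D) =
      N.lyapunov (fun i => h i + 1) - ∑ i ∈ D, N.deliveryGain h i := by
  have : ∑ i ∈ D, N.deliveryGain h i = ∑ i, if i ∈ D then N.deliveryGain h i else 0 := by
    rw [Finset.sum_ite_mem, Finset.univ_inter]
  rw [this, lyapunov, lyapunov, ← Finset.sum_sub_distrib]
  refine Finset.sum_congr rfl fun i _ => ?_
  by_cases hi : i ∈ D
  · simp only [nextAge, hi, if_true, deliveryGain]
    push_cast
    ring
  · simp [nextAge, hi]

/-- Gains collected so far plus the optimal value of the remaining slots form a martingale inside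
the frame, because the ages, hence the indices, stay fixed there and greedy choice is optimal. -/
theorem Policy.IsWhittle.mean_lyapunov_le {π : N.Policy} {h₁ : Fin M → ℕ}
    (hπ : π.IsWhittle h₁) (k : ℕ) :
    π.mean ((k + 1) * N.T) (fun w => N.lyapunov (N.age h₁ w)) ≤
      π.mean (k * N.T) (fun w => N.lyapunov (fun i => N.age h₁ w i + 1) -
        slotValue N.p (N.deliveryGain (N.age h₁ w)) N.T Finset.univ) := by
  have hp := fun i => (N.p_pos i).le
  refine (π.mean_frame_le h₁ (fun n h D => N.lyapunov (fun i => h i + 1) -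
    ∑ i ∈ D, N.deliveryGain h i - slotValue N.p (N.deliveryGain h) n Dᶜ) N.lyapunov
    (fun n w => π.stepMean_le w fun u hu => ?_) (fun h D => ?_) k).trans
      (π.mean_mono _ fun w _ => by simp)
  · by_cases hD : ∃ j, j ∉ N.delivered w
    · obtain ⟨i, rfl, hmax⟩ := hπ w u hu hD
      have hi := π.admissible w i hu
      rw [slotValue_eq_attemptValue hp N.p_le_one n (Finset.mem_compl.2 hi) fun j hj => by
        simpa only [whittleIndex_eq] using hmax j (Finset.mem_compl.1 hj)]
      rw [addDelivery_false, addDelivery_some_true, Finset.sum_insert hi, coe_successProb_some,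
        Finset.compl_insert, attemptValue]
      refine le_of_eq ?_
      ring
    -- Once everything is delivered, admissibility forces idling.
    · have hu' : u = none := by
        cases u with
        | none => rfl
        | some i => exact absurd ⟨i, π.admissible w i hu⟩ hD
      have hc : (N.delivered w)ᶜ = ∅ := by
        ext j
        simpa using not_exists_not.1 hD j
      subst hu'
      rw [addDelivery_none, addDelivery_none, hc, slotValue_empty, slotValue_empty]
      refine le_of_eq ?_
      ring
  · rw [lyapunov_nextAge]
    simp [slotValue]

/-- With `n = m + 1` this reduces to `(1 - q)^m * (1 + m * q) ≤ 1`, which is Bernoulli followed by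
`(1 - q^2)^m ≤ 1`. -/
theorem one_div_one_sub_pow_le {q : ℝ} (hq : 0 < q) (hq1 : q ≤ 1) {n : ℕ} (hn : 0 < n) :
    0 < 1 - (1 - q) ^ n ∧ 1 / (1 - (1 - q) ^ n) ≤ 1 / (n * q) + ((n : ℝ) - 1) / n := by
  have hn' : (0 : ℝ) < n := Nat.cast_pos.2 hn
  have hpos : 0 < 1 - (1 - q) ^ n :=
    sub_pos.2 (pow_lt_one₀ (by linarith) (by linarith) hn.ne')
  refine ⟨hpos, ?_⟩
  obtain ⟨m, rfl⟩ : ∃ m, n = m + 1 := ⟨n - 1, by omega⟩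
  have h1 : (1 - q) ^ m * (1 + m * q) ≤ 1 := by
    calc (1 - q) ^ m * (1 + m * q) ≤ (1 - q) ^ m * (1 + q) ^ m :=
          mul_le_mul_of_nonneg_left (one_add_mul_le_pow (by linarith) m)
            (pow_nonneg (by linarith) m)
      _ = (1 - q ^ 2) ^ m := by rw [← mul_pow]; ring
      _ ≤ 1 := pow_le_one₀ (by nlinarith) (by nlinarith)
  have h2 := mul_le_mul_of_nonneg_left h1 (sub_nonneg.2 hq1)
  have h3 : 1 / (((m + 1 : ℕ) : ℝ) * q) + (((m + 1 : ℕ) : ℝ) - 1) / ((m + 1 : ℕ) : ℝ) =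
      (1 + m * q) / ((m + 1) * q) := by
    push_cast
    field_simp
    ring
  rw [h3, div_le_div_iff₀ hpos (by positivity), pow_succ]
  nlinarith

/-- One frame of the randomized policy that serves client `i` with probability `d`. -/
theorem lyapunov_drift_le {h c d b : ℝ} (hc : 1 ≤ c) (hh : 0 ≤ h) (hd : 0 < d) (hd1 : d ≤ 1)
    (hb : 1 / d ≤ b) :
    (h + 1) ^ 2 + (c - 2) * (h + 1) - h * (h + c) * d ≤
      h ^ 2 + (c - 2) * h - h + (c + 2) ^ 2 * b := by
  have h1 : (c + 2) ^ 2 * (1 / d) ≤ (c + 2) ^ 2 * b := by gcongr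
  have h2 : 1 ≤ 1 / d := by rw [le_div_iff₀ hd]; linarith
  -- The drift apart from deliveries, plus the extra `h` to be extracted, has linear part `3 * h`;
  -- completing the square absorbs it into `d * h^2`.
  have h3 : 3 * h ≤ d * h ^ 2 + 9 / 4 * (1 / d) := by
    have : d * h ^ 2 + 9 / 4 * (1 / d) - 3 * h = d * (h - 3 / 2 * (1 / d)) ^ 2 := by
      field_simp
      ring
    have := mul_nonneg hd.le (sq_nonneg (h - 3 / 2 * (1 / d)))
    linarith
  have h4 : 0 ≤ d * c * h := by positivity
  have h5 : 0 ≤ ((c + 2) ^ 2 - 9 / 4) * (1 / d - 1) :=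
    mul_nonneg (by nlinarith) (sub_nonneg.2 h2)
  nlinarith

/-- Comparison with the policy that tries `i` with probability proportional to `√(alphaTilde i / p
i)`, the choice that minimizes `∑ alphaTilde i / (p i * β i)` (Cauchy–Schwarz). -/
theorem lyapunov_sub_slotValue_le (h : Fin M → ℕ) :
    N.lyapunov (fun i => h i + 1) - slotValue N.p (N.deliveryGain h) N.T Finset.univ ≤
      N.lyapunov h - N.weightedAge h + 2 / N.T * N.upperConst := by
  set r : Fin M → ℝ := fun i => √(N.alphaTilde i / N.p i) with hr
  set R : ℝ := ∑ i, r i with hR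
  have hT := T_pos_real (N := N)
  have hr0 : ∀ i, 0 < r i := fun i => Real.sqrt_pos.2 (div_pos (alphaTilde_pos i) (N.p_pos i))
  have hrsq : ∀ i, r i ^ 2 = N.alphaTilde i / N.p i := fun i =>
    Real.sq_sqrt (div_pos (alphaTilde_pos i) (N.p_pos i)).le
  have hRi : ∀ i, r i ≤ R := fun i =>
    Finset.single_le_sum (fun j _ => (hr0 j).le) (Finset.mem_univ i)
  have hβ : ∀ i, 0 ≤ r i / R := fun i => div_nonneg (hr0 i).le ((hr0 i).le.trans (hRi i))
  have hβ1 : ∑ i, r i / R ≤ 1 := by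
    rw [← Finset.sum_div, ← hR]
    exact div_self_le_one R
  have hV := sum_le_slotValue (fun i => (N.p_pos i).le) N.p_le_one (deliveryGain_nonneg (N := N) h) hβ N.T
    Finset.univ hβ1
  have hterm : ∀ i, N.α i * (((h i + 1 : ℕ) : ℝ) ^ 2 + (N.indexOffset i - 2) * ((h i + 1 : ℕ) : ℝ)) -
      N.deliveryGain h i * (1 - (1 - r i / R * N.p i) ^ N.T) ≤
      N.α i * ((h i : ℝ) ^ 2 + (N.indexOffset i - 2) * h i) - N.α i * h i +
        2 / N.T * (r i * R + (N.T - 1) * (N.alphaTilde i / N.p i)) := by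
    intro i
    have hp := N.p_pos i
    have hRpos := (hr0 i).trans_le (hRi i)
    have hq : 0 < r i / R * N.p i := mul_pos (div_pos (hr0 i) hRpos) hp
    have hq1 : r i / R * N.p i ≤ 1 :=
      mul_le_one₀ ((div_le_one hRpos).2 (hRi i)) hp.le (N.p_le_one i)
    obtain ⟨hd, hb⟩ := one_div_one_sub_pow_le hq hq1 N.T_pos
    have hT1 : (0 : ℝ) ≤ N.T - 1 := sub_nonneg.2 (by exact_mod_cast N.T_pos)
    -- A deliberate loss of a factor `1 / p i`, which yields the second term of `upperConst`.
    have hb' : ((N.T : ℝ) - 1) / N.T ≤ (N.T - 1) / N.T * (1 / N.p i) :=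
      le_mul_of_one_le_right (div_nonneg hT1 hT.le) ((one_le_div hp).2 (N.p_le_one i))
    have hdrift := lyapunov_drift_le (one_le_indexOffset (N := N) i) (Nat.cast_nonneg (h i)) hd
      (sub_le_self _ (pow_nonneg (sub_nonneg.2 hq1) _)) (hb.trans (add_le_add_right hb' _))
    have hmul := mul_le_mul_of_nonneg_left hdrift (N.α_pos i).le
    have hval : N.α i * ((N.indexOffset i + 2) ^ 2 *
        (1 / (N.T * (r i / R * N.p i)) + (N.T - 1) / N.T * (1 / N.p i))) =
        2 / N.T * (r i * R + (N.T - 1) * (N.alphaTilde i / N.p i)) := by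
      have e : N.α i * (N.indexOffset i + 2) ^ 2 = 2 * (r i ^ 2 * N.p i) := by
        rw [hrsq, div_mul_cancel₀ _ hp.ne', alphaTilde_eq]
        ring
      rw [← mul_assoc, e, ← hrsq]
      have := (hr0 i).ne'
      field_simp
    rw [deliveryGain]
    push_cast
    linarith
  have hsum := Finset.sum_le_sum fun i (_ : i ∈ Finset.univ) => hterm i
  rw [Finset.sum_sub_distrib, Finset.sum_add_distrib, Finset.sum_sub_distrib, ← Finset.mul_sum,
    Finset.sum_add_distrib, ← Finset.sum_mul, ← Finset.mul_sum, ← hR, ← sq] at hsum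
  have hU : N.upperConst = R ^ 2 + (N.T - 1) * ∑ i, N.alphaTilde i / N.p i := rfl
  rw [hU]
  simp only [lyapunov, weightedAge]
  linarith

theorem Policy.IsWhittle.sum_mean_weightedAge_le {π : N.Policy} {h₁ : Fin M → ℕ}
    (hh₁ : ∀ i, 1 ≤ h₁ i) (hπ : π.IsWhittle h₁) (K : ℕ) :
    ∑ k ∈ Finset.range K, π.mean (k * N.T) (fun w => N.weightedAge (N.age h₁ w)) ≤
      K * (2 / N.T * N.upperConst) + N.lyapunov h₁ := by
  have hK := π.mean_le_of_frame_le h₁ (G := N.lyapunov) (a := -1) (b := 2 / N.T * N.upperConst)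
    (fun k => (hπ.mean_lyapunov_le k).trans (π.mean_mono _ fun w _ =>
      (lyapunov_sub_slotValue_le _).trans (le_of_eq (by ring)))) K
  have h0 : 0 ≤ π.mean (K * N.T) fun w => N.lyapunov (N.age h₁ w) := by
    rw [← π.mean_const (K * N.T) 0]
    exact π.mean_mono _ fun w _ => lyapunov_nonneg (age_pos hh₁ w)
  linarith

/-! ### The performance guarantee -/

theorem lowerConst_pos (hM : 0 < M) : 0 < N.lowerConst := by
  have : Nonempty (Fin M) := ⟨⟨0, hM⟩⟩
  exact add_pos_of_nonneg_of_pos (sq_nonneg _)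
    (mul_pos T_pos_real (Finset.sum_pos (fun i _ => N.α_pos i) Finset.univ_nonempty))

theorem upperConst_nonneg : 0 ≤ N.upperConst :=
  add_nonneg (sq_nonneg _) (mul_nonneg (sub_nonneg.2 (by exact_mod_cast N.T_pos))
    (Finset.sum_nonneg fun i _ => (div_pos (alphaTilde_pos i) (N.p_pos i)).le))

theorem rhoWI_nonneg (hM : 0 < M) : 0 ≤ N.rhoWI :=
  mul_nonneg zero_le_four (div_nonneg upperConst_nonneg (lowerConst_pos hM).le)

end Network

open Network in
theorem mainTheorem4 {M : ℕ} (hM : 0 < M) (N : Network M) (h₁ : Fin M → ℕ) (hh₁ : ∀ i, 1 ≤ h₁ i)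
    (π : N.Policy) (hπ : π.IsWhittle h₁) :
    π.IsRhoOptimal h₁ N.rhoWI := by
  obtain ⟨C, hC⟩ := exists_le_sum_mean_weightedAge N h₁
  have hM' : (0 : ℝ) < M := Nat.cast_pos.2 hM
  have hT := T_pos_real (N := N)
  set lb : ℝ := N.lowerConst / (2 * N.T) / M with hlb
  set ub : ℝ := 2 / N.T * N.upperConst / M with hub
  have hL := lowerConst_pos (N := N) hM
  have hlb0 : 0 < lb := by positivity
  have hrho : N.rhoWI = ub / lb := by
    have : N.rhoWI = 4 * (N.upperConst / N.lowerConst) := rfl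
    rw [this, hub, hlb]
    field_simp
    ring
  -- For small K the bound may be negative and `ENNReal.ofReal` truncates it to 0; it is eventually
  -- positive, which the quotient below uses.
  have hlow : ∀ᶠ K : ℕ in atTop, ∀ η : N.Policy,
      ENNReal.ofReal (lb - C / M / K) ≤ η.cost h₁ K := by
    filter_upwards [eventually_gt_atTop 0] with K hK η
    have hK' : (0 : ℝ) < K := Nat.cast_pos.2 hK
    rw [η.cost_eq]
    refine ENNReal.ofReal_le_ofReal (le_trans (le_of_eq ?_)
      (mul_le_mul_of_nonneg_left (hC η K) (by positivity)))
    rw [hlb]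
    field_simp
  have hup : ∀ᶠ K : ℕ in atTop,
      π.cost h₁ K ≤ ENNReal.ofReal (ub + N.lyapunov h₁ / M / K) := by
    filter_upwards [eventually_gt_atTop 0] with K hK
    have hK' : (0 : ℝ) < K := Nat.cast_pos.2 hK
    rw [π.cost_eq]
    refine ENNReal.ofReal_le_ofReal (le_trans
      (mul_le_mul_of_nonneg_left (hπ.sum_mean_weightedAge_le hh₁ K) (by positivity)) (le_of_eq ?_))
    rw [hub]
    field_simp
  have hlim : Tendsto (fun K : ℕ => lb - C / M / K) atTop (nhds lb) := by
    simpa using (tendsto_const_div_atTop_nhds_zero_nat (C / M)).const_sub lb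
  have hlim' : Tendsto (fun K : ℕ => ub + N.lyapunov h₁ / M / K) atTop (nhds ub) := by
    simpa using (tendsto_const_div_atTop_nhds_zero_nat (N.lyapunov h₁ / M)).const_add ub
  constructor
  · have hratio : ∀ᶠ K : ℕ in atTop, π.cost h₁ K / ⨅ η : N.Policy, η.cost h₁ K ≤
        ENNReal.ofReal ((ub + N.lyapunov h₁ / M / K) / (lb - C / M / K)) := by
      filter_upwards [hlow, hup, hlim.eventually (lt_mem_nhds hlb0)] with K h1 h2 h3
      rw [ENNReal.ofReal_div_of_pos h3]
      exact ENNReal.div_le_div h2 (le_iInf h1)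
    refine (limsup_le_limsup hratio).trans (le_of_eq ?_)
    rw [hrho]
    exact (ENNReal.tendsto_ofReal (hlim'.div hlim hlb0.ne')).limsup_eq
  · intro η
    calc limsup (fun K => π.cost h₁ K) atTop
        ≤ limsup (fun K : ℕ => ENNReal.ofReal (ub + N.lyapunov h₁ / M / K)) atTop :=
          limsup_le_limsup hup
      _ = ENNReal.ofReal ub := (ENNReal.tendsto_ofReal hlim').limsup_eq
      _ = ENNReal.ofReal N.rhoWI * ENNReal.ofReal lb := by
          rw [← ENNReal.ofReal_mul (rhoWI_nonneg hM), hrho, div_mul_cancel₀ _ hlb0.ne']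
      _ = ENNReal.ofReal N.rhoWI *
          liminf (fun K : ℕ => ENNReal.ofReal (lb - C / M / K)) atTop := by
          rw [(ENNReal.tendsto_ofReal hlim).liminf_eq]
      _ ≤ ENNReal.ofReal N.rhoWI * liminf (fun K => η.cost h₁ K) atTop := 
          mul_le_mul' le_rfl (liminf_le_liminf (hlow.mono fun K h => h η))
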